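/- Let $V$ be a finite set, let $r \ge 1$ be an integer, let $\mathcal{M}_1,\dots,\mathcal{M}_r$ be matroids on the ground set $V$, and let $k > 0$ be a real number. For a matroid $\mathcal{M}$ on $V$ with rank function $\mathrm{rk}_{\mathcal{M}}$, let $$P(\mathcal{M}) = \Big\{ f \in \mathbb{R}_{\ge 0}^V : \sum_{v \in A} f(v) \le \mathrm{rk}_{\mathcal{M}}(A) \text{ for every } A \subseteq V \Big\}.$$ For $W \subseteq V$ let $$\nu^*(W) = \max\Big\{ \sum_{v \in V} f(v) : f \in \bigcap_{i=1}^r P(\mathcal{M}_i),\ \mathrm{supp}(f) \subseteq W \Big\}.$$ A complex on $V$ is a downward-closed collection of subsets of $V$, called its faces (the empty set is a face of every nonempty complex). If $\sigma$ is a face of a complex $\mathcal{C}$ with $|\sigma| \le d$ that is contained in a unique maximal face of $\mathcal{C}$, then removing from $\mathcal{C}$ all faces containing $\sigma$ is called a $d$-collapse. The complex $\mathcal{C}$ is $d$-collapsible if it can be reduced to the complex with no faces by a finite sequence of $d$-collapses. Let $\mathcal{X}_k$ be the complex of all sets $W \subseteq V$ with $\nu^*(W) < k$. Then $\mathcal{X}_k$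 is $(r\lceil k \rceil - r)$-collapsible. -/

import Mathlib

namespace MatroidalMatching

/-- A (finite) complex on `V`: a downward-closed collection of finite sets (`LowerSet (Finset V)`).
The empty set is a face of every nonempty complex; `⊥` is the complex with no faces at all.

`IsCollapse d C C'` says that `C'` arises from `C` by a `d`-collapse: there is a face `σ` of `C`
with `|σ| ≤ d`, contained in a unique maximal face of `C`, such that `C'` is obtained from `C` by
removing all faces that contain `σ`. -/
def IsCollapse {V : Type*} (d : ℕ) (C C' : LowerSet (Finset V)) : Prop :=
  ∃ σ ∈ C, σ.card ≤ d ∧ (∃! τ, Maximal (fun ρ => ρ ∈ C) τ ∧ σ ⊆ τ) ∧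
    ∀ τ, τ ∈ C' ↔ τ ∈ C ∧ ¬ σ ⊆ τ

/-- A complex is `d`-collapsible if it can be reduced to the complex with no faces by a finite
sequence of `d`-collapses. -/
def IsCollapsible {V : Type*} (d : ℕ) (C : LowerSet (Finset V)) : Prop :=
  Relation.ReflTransGen (IsCollapse d) C ⊥

/-- The matroid polytope `P(M)`: the nonnegative `f : V → ℝ` with `f[A] ≤ rk_M A` for all `A`.
(All ranks are finite as `V` is finite.) -/
def matroidPolytope {V : Type*} [Fintype V] (M : Matroid V) : Set (V → ℝ) :=
  {f | (∀ v, 0 ≤ f v) ∧ ∀ A : Finset V, ∑ v ∈ A, f v ≤ ((M.eRk (A : Set V)).toNat : ℝ)}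

/-- The set of functions in `⋂ i, P(M i)` with support in `W`. -/
def fractionalMatchings {V : Type*} [Fintype V] {r : ℕ} (M : Fin r → Matroid V)
    (W : Finset V) : Set (V → ℝ) :=
  {f | f ∈ ⋂ i, matroidPolytope (M i) ∧ Function.support f ⊆ (W : Set V)}

/-- The matroidal fractional matching number `ν*(W)`: the maximum of `|f| = ∑ v, f v` over
`f ∈ ⋂ i, P(M i)` with support in `W`. For `r ≥ 1` the maximum is attained, see `isGreatest_nuStar`. -/
noncomputable def nuStar {V : Type*} [Fintype V] {r : ℕ} (M : Fin r → Matroid V)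
    (W : Finset V) : ℝ :=
  sSup ((fun f : V → ℝ => ∑ v, f v) '' fractionalMatchings M W)

theorem isCompact_fractionalMatchings {V : Type*} [Fintype V] {r : ℕ} [NeZero r]
    (M : Fin r → Matroid V) (W : Finset V) : IsCompact (fractionalMatchings M W) := by
  refine (isCompact_Icc (a := (0 : V → ℝ))
    (b := fun v => (((M 0).eRk (({v} : Finset V) : Set V)).toNat : ℝ))).of_isClosed_subset ?_ ?_
  · have h : fractionalMatchings M W =
        (⋂ i, ((⋂ v, {f : V → ℝ | 0 ≤ f v}) ∩
          ⋂ A : Finset V, {f : V → ℝ | ∑ v ∈ A, f v ≤ (((M i).eRk (A : Set V)).toNat : ℝ)})) ∩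
        ⋂ v, ⋂ _ : v ∉ W, {f : V → ℝ | f v = 0} := by
      ext f
      simp only [fractionalMatchings, matroidPolytope, Set.mem_ofPred_eq, Set.mem_iInter,
        Set.mem_inter_iff, Function.support_subset_iff']
      rfl
    rw [h]
    refine IsClosed.inter (isClosed_iInter fun i => IsClosed.inter ?_ ?_) ?_
    · exact isClosed_iInter fun v => isClosed_le continuous_const (continuous_apply v)
    · exact isClosed_iInter fun A => isClosed_le (by fun_prop) continuous_const
    · exact isClosed_iInter fun v => isClosed_iInter fun _ =>
        isClosed_eq (continuous_apply v) continuous_const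
  · intro f hf
    have h0 := Set.mem_iInter.1 hf.1 0
    refine ⟨fun v => h0.1 v, fun v => ?_⟩
    have := h0.2 {v}
    rwa [Finset.sum_singleton] at this

theorem zero_mem_fractionalMatchings {V : Type*} [Fintype V] {r : ℕ}
    (M : Fin r → Matroid V) (W : Finset V) : (0 : V → ℝ) ∈ fractionalMatchings M W := by
  refine ⟨Set.mem_iInter.2 fun i => ⟨fun v => le_refl _, fun A => ?_⟩, by simp⟩
  simp

/-- The maximum defining `ν*(W)` is attained. -/
theorem isGreatest_nuStar {V : Type*} [Fintype V] {r : ℕ} [NeZero r]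
    (M : Fin r → Matroid V) (W : Finset V) :
    IsGreatest ((fun f : V → ℝ => ∑ v, f v) '' fractionalMatchings M W) (nuStar M W) :=
  ((isCompact_fractionalMatchings M W).image (by fun_prop)).isGreatest_sSup
    ⟨_, Set.mem_image_of_mem _ (zero_mem_fractionalMatchings M W)⟩

theorem nuStar_mono {V : Type*} [Fintype V] {r : ℕ} [NeZero r]
    (M : Fin r → Matroid V) {W W' : Finset V} (h : W ⊆ W') : nuStar M W ≤ nuStar M W' := by
  obtain ⟨f, hf, hfs⟩ := (isGreatest_nuStar M W).1
  exact (isGreatest_nuStar M W').2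
    ⟨f, ⟨hf.1, hf.2.trans (Finset.coe_subset.2 h)⟩, hfs⟩

/-- The complex `X_k` of all `W ⊆ V` with `ν*(W) < k`. -/
noncomputable def matchingComplex {V : Type*} [Fintype V] {r : ℕ} [NeZero r]
    (M : Fin r → Matroid V) (k : ℝ) : LowerSet (Finset V) where
  carrier := {W | nuStar M W < k}
  lower' := fun _ _ hle hW => lt_of_le_of_lt (nuStar_mono M hle) hW

end MatroidalMatching

/-!
Write `P` for the polytope `⋂ i, P(M i)` and sweep `X_k` from the faces of largest `ν*` downwards.
Suppose that for every face `W` there are sets `S ⊆ U` such that the faces `F` with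
`ν*(F) = ν*(W)` are exactly those with `S ⊆ F ⊆ U`. Then the faces containing `S`, for a `W` of
largest value, all have that value, `U` is the unique maximal one among them, and removing them
leaves a smaller sublevel set of `ν*`
(`isCollapsible_of_forall_level_interval`). So the level sets of `ν*` have to be intervals with
lower ends of size at most `r (⌈k⌉ - 1)`. This is true after a small perturbation of the linear
program that does not change `X_k`:

* The constraint `f[A] ≤ rk_i A` is replaced by `f[A] ≤ φ_i (rk_i A)`, where `φ_i` is close to the
  identity and strictly concave on the occurring ranks (`exists_isGenericPerturbation`). Strict
  concavity makes `φ_i ∘ rk_i` strictly submodular on incomparable flats, so that uncrossing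
  turns the tight flats of each matroid at a point `f` into a chain, on which the rank is
  injective (`injOn_rank_tightFlats`). As the perturbation depends on the rank only, the number
  of tight flats of positive rank is still at most the number of pairs `(i, j)` with `1 ≤ j < k`
  (`card_tightFlats_le`). Genericity of `φ` makes the indicator vectors of the tight flats
  linearly independent on the support of `f` (`IsGenericPerturbation.eq_zero_of_sum_eq_zero`).
* The objective `∑ v, f v` is replaced by `c ⬝ᵥ f` with `c` generic and close to `1`
  (`exists_isGenericObjective`). Then every optimum `f` is a basic point, whose support is no
  larger than its set of tight flats, and an optimum is determined by its value
  (`IsOptimalOn.isBasic`, `IsOptimalOn.eq_of_dotProduct_eq`).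

Consequently all `F` of the same value as `W` have the same optimum `f` as `W`, in particular they
contain `S = supp f`. What remains is locality (`isOptimalOn_of_forall_insert`): if `f` is optimal
on `S ∪ {v}` for every `v ∈ F`, then it is optimal on `F`. By linear independence each unit vector
`e_v` can be corrected on `S` to a direction that keeps all tight flats tight; every feasible
direction at `f` is a nonnegative combination of such corrected unit vectors plus a feasible
direction supported on `S`, and none of these increases the objective. Hence `U` is the set of all
`v` for which `f` is optimal on `S ∪ {v}`.
-/

namespace MatroidalMatching

open Filter Topology

/-! ### Hyperplane avoidance and sums over a subset of coordinates -/

theorem exists_near_forall_dotProduct_ne_zero {κ : Type*} [Fintype κ] {D : Set (κ → ℝ)}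
    (hD : D.Finite) (h0 : (0 : κ → ℝ) ∉ D) (x₀ : κ → ℝ) {δ : ℝ} (hδ : 0 < δ) :
    ∃ x : κ → ℝ, (∀ j, |x j - x₀ j| < δ) ∧ ∀ u ∈ D, u ⬝ᵥ x ≠ 0 := by
  induction D, hD using Set.Finite.induction_on with
  | empty => exact ⟨x₀, by simpa using fun _ => hδ, by simp⟩
  | @insert u D _ hfin ih =>
    obtain ⟨x, hx, hxD⟩ := ih fun h => h0 (Set.mem_insert_of_mem _ h)
    have hu : u ≠ 0 := fun h => h0 (h ▸ Set.mem_insert _ _)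
    by_cases hux : u ⬝ᵥ x = 0
    -- A small move in direction `u` leaves the hyperplane `uᗮ` and stays off the others.
    · have hnear : ∀ᶠ t in 𝓝[>] (0 : ℝ), ∀ j, |(x + t • u) j - x₀ j| < δ := by
        refine eventually_all.2 fun j => ?_
        have hc : Continuous fun t : ℝ => |(x + t • u) j - x₀ j| := by
          simp only [Pi.add_apply, Pi.smul_apply, smul_eq_mul]; fun_prop
        exact nhdsWithin_le_nhds (hc.continuousAt.eventually_lt continuousAt_const
          (by simpa using hx j))
      have hoff : ∀ᶠ t in 𝓝[>] (0 : ℝ), ∀ w ∈ D, w ⬝ᵥ (x + t • u) ≠ 0 := by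
        refine (eventually_all_finite hfin).2 fun w hw => ?_
        have hc : Continuous fun t : ℝ => w ⬝ᵥ (x + t • u) := by
          simp only [dotProduct_add, dotProduct_smul, smul_eq_mul]; fun_prop
        exact nhdsWithin_le_nhds (hc.continuousAt.eventually_ne (by simpa using hxD w hw))
      obtain ⟨t, ⟨ht1, ht2⟩, ht⟩ :=
        ((hnear.and hoff).and self_mem_nhdsWithin).exists
      refine ⟨x + t • u, ht1, ?_⟩
      rintro w (rfl | hw)
      · rw [dotProduct_add, hux, zero_add, dotProduct_smul, smul_eq_mul]
        exact mul_ne_zero (ne_of_gt ht) (by simpa [dotProduct_self_eq_zero] using hu)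
      · exact ht2 w hw
    · refine ⟨x, hx, ?_⟩
      rintro w (rfl | hw)
      exacts [hux, hxD w hw]

theorem sum_dite_mem {V : Type*} [DecidableEq V] (S A : Finset V) (w : S → ℝ) :
    ∑ v ∈ A, (if hv : v ∈ S then w ⟨v, hv⟩ else 0) = ∑ v : S, if (v : V) ∈ A then w v else 0 := by
  have h1 : ∀ v : S, (if (v : V) ∈ A then w v else 0) =
      (fun v : V => if v ∈ A then (if hv : v ∈ S then w ⟨v, hv⟩ else 0) else 0) v := fun v => by
    simp
  rw [Finset.sum_congr rfl fun v _ => h1 v, Finset.sum_coe_sort S (fun v : V =>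
    if v ∈ A then (if hv : v ∈ S then w ⟨v, hv⟩ else 0) else 0), ← Finset.sum_filter,
    Finset.filter_mem_eq_inter]
  refine (Finset.sum_subset Finset.inter_subset_right fun v hv hvn => dif_neg fun h => ?_).symm
  exact hvn (Finset.mem_inter.2 ⟨h, hv⟩)

/-! ### Rank functions, flats and the perturbed polytope -/

section Polytope

variable {V ι : Type*}

/-- A flat of a rank function: a set all of whose proper supersets have larger rank. -/
def IsFlat (ρ : Finset V → ℕ) (A : Finset V) : Prop :=
  ∀ B, A ⊂ B → ρ A < ρ B

theorem exists_isFlat_superset [Fintype V] (ρ : Finset V → ℕ) (hρ : Monotone ρ) (A : Finset V) :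
    ∃ B, A ⊆ B ∧ ρ B = ρ A ∧ IsFlat ρ B := by
  obtain ⟨B, hAB, hB⟩ := (Set.toFinite {B | ρ B = ρ A}).exists_le_maximal (a := A) rfl
  refine ⟨B, hAB, hB.prop, fun C hBC => (hρ hBC.subset).lt_of_ne fun h => ?_⟩
  exact hBC.not_subset (hB.le_of_ge (h.symm.trans hB.prop) hBC.subset)

open Classical in
/-- The support of `f`, as a `Finset`. -/
noncomputable def supportFinset [Fintype V] (f : V → ℝ) : Finset V :=
  Finset.univ.filter fun v => f v ≠ 0

@[simp] theorem mem_supportFinset [Fintype V] {f : V → ℝ} {v : V} :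
    v ∈ supportFinset f ↔ f v ≠ 0 := by
  simp [supportFinset]

open Classical in
/-- The pairs `(i, A)` such that `A` is a flat of positive rank of `ρ i` whose constraint
`∑ v ∈ A, f v ≤ φ i (ρ i A)` holds with equality. Flats of rank `0` are left out: their constraint
is always tight, but it is trivial on the support of `f`. -/
noncomputable def tightFlats [Fintype V] [Fintype ι] (ρ : ι → Finset V → ℕ) (φ : ι → ℕ → ℝ)
    (f : V → ℝ) : Finset (ι × Finset V) :=
  Finset.univ.filter fun p =>
    0 < ρ p.1 p.2 ∧ IsFlat (ρ p.1) p.2 ∧ ∑ v ∈ p.2, f v = φ p.1 (ρ p.1 p.2)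

theorem mem_tightFlats [Fintype V] [Fintype ι] {ρ : ι → Finset V → ℕ} {φ : ι → ℕ → ℝ} {f : V → ℝ}
    {p : ι × Finset V} : p ∈ tightFlats ρ φ f ↔
      0 < ρ p.1 p.2 ∧ IsFlat (ρ p.1) p.2 ∧ ∑ v ∈ p.2, f v = φ p.1 (ρ p.1 p.2) := by
  simp [tightFlats]

/-- `f` maximizes `c ⬝ᵥ f` among the points of `P` that vanish outside `W`. -/
structure IsOptimalOn [Fintype V] (P : Set (V → ℝ)) (c : V → ℝ) (W : Finset V) (f : V → ℝ) :
    Prop where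
  mem : f ∈ P
  eq_zero : ∀ v ∉ W, f v = 0
  le : ∀ g ∈ P, (∀ v ∉ W, g v = 0) → c ⬝ᵥ g ≤ c ⬝ᵥ f

theorem IsOptimalOn.supportFinset_subset [Fintype V] {f : V → ℝ} {P : Set (V → ℝ)} {c : V → ℝ}
    {W : Finset V} (h : IsOptimalOn P c W f) : supportFinset f ⊆ W := fun v hv => by
  by_contra hW
  exact mem_supportFinset.1 hv (h.eq_zero v hW)

theorem IsOptimalOn.mono [Fintype V] {f : V → ℝ} {P : Set (V → ℝ)} {c : V → ℝ} {W W' : Finset V}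
    (h : IsOptimalOn P c W f) (hW : W' ⊆ W) (hf : supportFinset f ⊆ W') : IsOptimalOn P c W' f where
  mem := h.mem
  eq_zero v hv := by
    by_contra h0
    exact hv (hf (mem_supportFinset.2 h0))
  le g hg hgW := h.le g hg fun v hv => hgW v fun hv' => hv (hW hv')

/-- `f` is a basic point: the equations of its tight flats together with the vanishing outside its
support determine it, that is, the homogeneous system has only the zero solution. -/
def IsBasic [Fintype V] [Fintype ι] (ρ : ι → Finset V → ℕ) (φ : ι → ℕ → ℝ) (f : V → ℝ) : Prop :=
  ∀ u : V → ℝ, (∀ v, f v = 0 → u v = 0) → (∀ p ∈ tightFlats ρ φ f, ∑ v ∈ p.2, u v = 0) → u = 0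

/-- There are finitely many basic points, since such a point is determined by its support and its
tight flats. -/
theorem finite_setOf_isBasic [Fintype V] [Fintype ι] (ρ : ι → Finset V → ℕ) (φ : ι → ℕ → ℝ) :
    {f | IsBasic ρ φ f}.Finite := by
  refine Set.Finite.of_finite_image (f := fun f => (supportFinset f, tightFlats ρ φ f))
    (Set.toFinite _) ?_
  intro f hf g _ h
  obtain ⟨hs, ht⟩ := Prod.mk.inj h
  refine sub_eq_zero.1 (hf (f - g) (fun v hv => ?_) fun p hp => ?_)
  · have : g v = 0 := by
      by_contra h0
      have := mem_supportFinset.2 h0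
      rw [← hs] at this
      exact mem_supportFinset.1 this hv
    simp [hv, this]
  · have h1 := (mem_tightFlats.1 hp).2.2
    rw [ht] at hp
    have h2 := (mem_tightFlats.1 hp).2.2
    simp [h1, h2]

variable [DecidableEq V]

/-- The properties of a matroid rank function that are used: it is an integer-valued, monotone and
submodular set function. -/
structure IsRankFunction (ρ : Finset V → ℕ) : Prop where
  mono : Monotone ρ
  submod : ∀ A B, ρ (A ∪ B) + ρ (A ∩ B) ≤ ρ A + ρ B

/-- By submodularity, intersecting with a flat that does not contain `A` lowers the rank of `A`. -/
theorem IsFlat.rank_inter_lt {ρ : Finset V → ℕ} (hρ : IsRankFunction ρ) {A B : Finset V}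
    (hB : IsFlat ρ B) (hAB : ¬ A ⊆ B) : ρ (A ∩ B) < ρ A := by
  refine (hρ.mono Finset.inter_subset_left).lt_of_ne fun h => ?_
  have h1 := hB (A ∪ B) ⟨Finset.subset_union_right,
    fun hu => hAB (Finset.subset_union_left.trans hu)⟩
  have h2 := hρ.submod A B
  omega

/-- The polytope `P(M 1) ∩ … ∩ P(M r)` with the bound `ρ i A` replaced by `φ i (ρ i A)`. -/
def rankPolytope (ρ : ι → Finset V → ℕ) (φ : ι → ℕ → ℝ) : Set (V → ℝ) :=
  {f | (∀ v, 0 ≤ f v) ∧ ∀ i A, ∑ v ∈ A, f v ≤ φ i (ρ i A)}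

/-- The conditions on the perturbed bounds `φ i (ρ i A)`: rank `0` is not perturbed, the bounds are
strictly submodular at pairs whose intersection has smaller rank than both, and no linear relation
between the indicator vectors (on a set `S`) of sets with distinct ranks is satisfied by the bounds
by accident. The last condition asks only for one violated relation for each `S` and `T`, so that
finitely many hyperplanes have to be avoided. -/
structure IsGenericPerturbation (ρ : ι → Finset V → ℕ) (φ : ι → ℕ → ℝ) : Prop where
  zero : ∀ i, φ i 0 = 0
  strict : ∀ i A B, ρ i (A ∩ B) < ρ i A → ρ i (A ∩ B) < ρ i B →
    φ i (ρ i (A ∪ B)) + φ i (ρ i (A ∩ B)) < φ i (ρ i A) + φ i (ρ i B)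
  generic : ∀ (S : Finset V) (T : Finset (ι × Finset V)),
    Set.InjOn (fun p : ι × Finset V => (p.1, ρ p.1 p.2)) T → (∀ p ∈ T, 0 < ρ p.1 p.2) →
    (∃ l : ι × Finset V → ℝ, (∃ p ∈ T, l p ≠ 0) ∧
      ∀ v ∈ S, ∑ p ∈ T, (if v ∈ p.2 then l p else 0) = 0) →
    ∃ l : ι × Finset V → ℝ, (∀ v ∈ S, ∑ p ∈ T, (if v ∈ p.2 then l p else 0) = 0) ∧
      ∑ p ∈ T, l p * φ p.1 (ρ p.1 p.2) ≠ 0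

variable {ρ : ι → Finset V → ℕ} {φ : ι → ℕ → ℝ} {f : V → ℝ}

theorem eq_zero_of_rank_singleton (hφ : IsGenericPerturbation ρ φ) (hf : f ∈ rankPolytope ρ φ)
    {i : ι} {v : V} (h : ρ i {v} = 0) : f v = 0 := by
  have := hf.2 i {v}
  rw [h, hφ.zero, Finset.sum_singleton] at this
  exact le_antisymm this (hf.1 v)

variable [Fintype V] [Fintype ι]

/-- Uncrossing: two tight flats of the same `ρ i` are comparable, so they are equal if they have the
same rank. -/
theorem injOn_rank_tightFlats (hρ : ∀ i, IsRankFunction (ρ i)) (hφ : IsGenericPerturbation ρ φ)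
    (hf : f ∈ rankPolytope ρ φ) :
    Set.InjOn (fun p : ι × Finset V => (p.1, ρ p.1 p.2)) (tightFlats ρ φ f) := by
  rintro ⟨i, A⟩ hA ⟨j, B⟩ hB h
  obtain ⟨rfl, hr⟩ := Prod.mk.inj h
  obtain ⟨-, fA, tA⟩ := mem_tightFlats.1 hA
  obtain ⟨-, fB, tB⟩ := mem_tightFlats.1 hB
  dsimp only at *
  by_cases hAB : A ⊆ B
  · rcases hAB.eq_or_ssubset with rfl | hss
    · rfl
    · exact absurd (fA B hss) (by omega)
  by_cases hBA : B ⊆ A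
  · rcases hBA.eq_or_ssubset with rfl | hss
    · rfl
    · exact absurd (fB A hss) (by omega)
  have h1 := fB.rank_inter_lt (hρ i) hAB
  have h2 := fA.rank_inter_lt (hρ i) hBA
  rw [Finset.inter_comm] at h2
  have h3 := hφ.strict i A B h1 h2
  have h4 := hf.2 i (A ∪ B)
  have h5 := hf.2 i (A ∩ B)
  have h6 := Finset.sum_union_inter (s₁ := A) (s₂ := B) (f := f)
  linarith

/-- Directions in which one can leave `f` without leaving the polytope at once, see
`IsFeasibleDirection.exists_add_smul_mem`. Elements `v` of rank `0` need a condition of their own,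
as `tightFlats` does not see flats of rank `0`. -/
structure IsFeasibleDirection (ρ : ι → Finset V → ℕ) (φ : ι → ℕ → ℝ) (f u : V → ℝ) : Prop where
  nonneg : ∀ v, f v = 0 → 0 ≤ u v
  loop : ∀ i v, ρ i {v} = 0 → u v = 0
  tight : ∀ p ∈ tightFlats ρ φ f, ∑ v ∈ p.2, u v ≤ 0

/-- A tight set `A` that is not a flat is contained in a flat of the same rank, which is tight as
well, and `f` vanishes on the difference. So the condition on tight flats suffices. -/
theorem IsFeasibleDirection.sum_nonpos {u : V → ℝ} (hρ : ∀ i, IsRankFunction (ρ i))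
    (hf : f ∈ rankPolytope ρ φ) (hu : IsFeasibleDirection ρ φ f u) {i : ι} {A : Finset V}
    (hA : ∑ v ∈ A, f v = φ i (ρ i A)) : ∑ v ∈ A, u v ≤ 0 := by
  rcases Nat.eq_zero_or_pos (ρ i A) with h0 | hpos
  · refine (Finset.sum_eq_zero fun v hv => hu.loop i v ?_).le
    have := (hρ i).mono (Finset.singleton_subset_iff.2 hv)
    omega
  obtain ⟨B, hAB, hr, hB⟩ := exists_isFlat_superset (ρ i) (hρ i).mono A
  have hsB := hf.2 i B
  have hsplit := Finset.sum_sdiff (f := f) hAB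
  have hge : 0 ≤ ∑ v ∈ B \ A, f v := Finset.sum_nonneg fun v _ => hf.1 v
  rw [hr] at hsB
  have hzero : ∑ v ∈ B \ A, f v = 0 := by linarith
  have hz := (Finset.sum_eq_zero_iff_of_nonneg fun v _ => hf.1 v).1 hzero
  have hut : ∑ v ∈ B, u v ≤ 0 :=
    hu.tight (i, B) (mem_tightFlats.2 ⟨by simpa [hr] using hpos, hB, by simp only [hr]; linarith⟩)
  have hun : 0 ≤ ∑ v ∈ B \ A, u v := Finset.sum_nonneg fun v hv => hu.nonneg v (hz v hv)
  have := Finset.sum_sdiff (f := u) hAB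
  linarith

theorem IsFeasibleDirection.exists_add_smul_mem {u : V → ℝ} (hρ : ∀ i, IsRankFunction (ρ i))
    (hf : f ∈ rankPolytope ρ φ) (hu : IsFeasibleDirection ρ φ f u) :
    ∃ t : ℝ, 0 < t ∧ f + t • u ∈ rankPolytope ρ φ := by
  have h1 : ∀ᶠ t in 𝓝[>] (0 : ℝ), ∀ v, 0 ≤ f v + t * u v := by
    refine eventually_all.2 fun v => ?_
    rcases (hf.1 v).eq_or_lt' with h | h
    · filter_upwards [self_mem_nhdsWithin] with t ht
      rw [h, zero_add]
      exact mul_nonneg (le_of_lt ht) (hu.nonneg v h)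
    · have hc : Continuous fun t : ℝ => f v + t * u v := by fun_prop
      filter_upwards [nhdsWithin_le_nhds (continuousAt_const.eventually_lt hc.continuousAt
        (by simpa using h))] with t ht using le_of_lt ht
  have h2 : ∀ᶠ t in 𝓝[>] (0 : ℝ), ∀ i A, ∑ v ∈ A, f v + t * ∑ v ∈ A, u v ≤ φ i (ρ i A) := by
    refine eventually_all.2 fun i => eventually_all.2 fun A => ?_
    rcases (hf.2 i A).eq_or_lt with h | h
    · filter_upwards [self_mem_nhdsWithin] with t ht
      have := mul_nonpos_of_nonneg_of_nonpos (le_of_lt ht) (hu.sum_nonpos hρ hf h)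
      linarith
    · have hc : Continuous fun t : ℝ => ∑ v ∈ A, f v + t * ∑ v ∈ A, u v := by fun_prop
      filter_upwards [nhdsWithin_le_nhds (hc.continuousAt.eventually_lt continuousAt_const
        (by simpa using h))] with t ht using le_of_lt ht
  obtain ⟨t, ⟨ht1, ht2⟩, ht⟩ := ((h1.and h2).and self_mem_nhdsWithin).exists
  refine ⟨t, ht, fun v => ht1 v, fun i A => ?_⟩
  simpa [Finset.sum_add_distrib, Finset.mul_sum] using ht2 i A

theorem IsOptimalOn.dotProduct_nonpos {c u : V → ℝ} {W : Finset V}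
    (hρ : ∀ i, IsRankFunction (ρ i)) (h : IsOptimalOn (rankPolytope ρ φ) c W f)
    (hu : IsFeasibleDirection ρ φ f u) (huW : ∀ v ∉ W, u v = 0) : c ⬝ᵥ u ≤ 0 := by
  obtain ⟨t, ht, hmem⟩ := hu.exists_add_smul_mem hρ h.mem
  have := h.le _ hmem fun v hv => by simp [h.eq_zero v hv, huW v hv]
  rw [dotProduct_add, dotProduct_smul, smul_eq_mul] at this
  by_contra! hpos
  nlinarith [mul_pos ht hpos]

theorem IsBasic.card_supportFinset_le (hf : IsBasic ρ φ f) :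
    (supportFinset f).card ≤ (tightFlats ρ φ f).card := by
  let L : (supportFinset f → ℝ) →ₗ[ℝ] (tightFlats ρ φ f → ℝ) :=
    LinearMap.pi fun p => ∑ v : supportFinset f,
      if (v : V) ∈ p.1.2 then LinearMap.proj v else 0
  have hL : Function.Injective L := by
    refine (injective_iff_map_eq_zero L).2 fun u hu => ?_
    let w : V → ℝ := fun v => if hv : v ∈ supportFinset f then u ⟨v, hv⟩ else 0
    have hw : w = 0 := by
      refine hf w (fun v hv => ?_) fun p hp => ?_
      · exact dif_neg (by simp [hv])
      · have h1 := congrFun hu ⟨p, hp⟩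
        refine (sum_dite_mem _ _ u).trans (Eq.trans ?_ h1)
        simp only [L, LinearMap.pi_apply, LinearMap.sum_apply]
        refine Finset.sum_congr rfl fun v _ => ?_
        split_ifs <;> rfl
    funext v
    have := congrFun hw v
    simpa only [w, dif_pos v.2, Subtype.coe_eta, Pi.zero_apply] using this
  simpa only [Module.finrank_fintype_fun_eq_card, Fintype.card_coe] using
    LinearMap.finrank_le_finrank_of_injective hL

/-- The indicator vectors of the tight flats are linearly independent on the support of `f`: every
linear relation between them is passed on, by pairing with `f`, to the bounds `φ i (ρ i A)`. -/
theorem IsGenericPerturbation.eq_zero_of_sum_eq_zero (hρ : ∀ i, IsRankFunction (ρ i))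
    (hφ : IsGenericPerturbation ρ φ) (hf : f ∈ rankPolytope ρ φ) {l : ι × Finset V → ℝ}
    (hl : ∀ v ∈ supportFinset f, ∑ p ∈ tightFlats ρ φ f, (if v ∈ p.2 then l p else 0) = 0) :
    ∀ p ∈ tightFlats ρ φ f, l p = 0 := by
  by_contra! hne
  obtain ⟨l', hl', h0⟩ := hφ.generic (supportFinset f) (tightFlats ρ φ f)
    (injOn_rank_tightFlats hρ hφ hf) (fun p hp => (mem_tightFlats.1 hp).1) ⟨l, hne, hl⟩
  refine h0 ?_
  calc ∑ p ∈ tightFlats ρ φ f, l' p * φ p.1 (ρ p.1 p.2)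
      = ∑ p ∈ tightFlats ρ φ f, ∑ v, f v * (if v ∈ p.2 then l' p else 0) := by
        refine Finset.sum_congr rfl fun p hp => ?_
        rw [← (mem_tightFlats.1 hp).2.2, Finset.mul_sum]
        simp [mul_comm]
    _ = ∑ v, f v * ∑ p ∈ tightFlats ρ φ f, (if v ∈ p.2 then l' p else 0) := by
        rw [Finset.sum_comm]
        simp only [Finset.mul_sum]
    _ = 0 := Finset.sum_eq_zero fun v _ => by
        by_cases hv : v ∈ supportFinset f
        · rw [hl' v hv, mul_zero]
        · rw [not_not.1 (mt mem_supportFinset.2 hv), zero_mul]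

open Classical in
theorem IsGenericPerturbation.exists_prescribed_sums (hρ : ∀ i, IsRankFunction (ρ i))
    (hφ : IsGenericPerturbation ρ φ) (hf : f ∈ rankPolytope ρ φ) (y : ι × Finset V → ℝ) :
    ∃ u : V → ℝ, (∀ v, f v = 0 → u v = 0) ∧
      ∀ p ∈ tightFlats ρ φ f, ∑ v ∈ p.2, u v = y p := by
  let B : tightFlats ρ φ f → supportFinset f → ℝ := fun p v => if (v : V) ∈ p.1.2 then 1 else 0
  have hB : LinearIndependent ℝ B := by
    refine Fintype.linearIndependent_iff.2 fun l hl p => ?_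
    let l' : ι × Finset V → ℝ := fun p => if hp : p ∈ tightFlats ρ φ f then l ⟨p, hp⟩ else 0
    have := hφ.eq_zero_of_sum_eq_zero hρ hf (l := l') (fun v hv => ?_) p p.2
    · simpa [l'] using this
    · have h1 := congrFun hl ⟨v, hv⟩
      rw [← Finset.sum_coe_sort]
      simpa [B, l'] using h1
  have hmem : (fun p : tightFlats ρ φ f => y p) ∈ Submodule.span ℝ (Set.range (flip B)) := by
    rw [span_flip_eq_top_iff_linearIndependent.2 hB]; trivial
  obtain ⟨w, hw⟩ := (Submodule.mem_span_range_iff_exists_fun ℝ).1 hmem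
  let u : V → ℝ := fun v => if hv : v ∈ supportFinset f then w ⟨v, hv⟩ else 0
  refine ⟨u, fun v hv => dif_neg (by simp [hv]), fun p hp => ?_⟩
  rw [sum_dite_mem, ← show _ = y p from congrFun hw ⟨p, hp⟩]
  simp [B, flip]

end Polytope

/-! ### Optima for a generic objective -/

theorem exists_isOptimalOn {V ι : Type*} [Fintype V] [Nonempty ι] {ρ : ι → Finset V → ℕ}
    {φ : ι → ℕ → ℝ} (hφ : ∀ i A, 0 ≤ φ i (ρ i A)) (c : V → ℝ)
    (W : Finset V) : ∃ f, IsOptimalOn (rankPolytope ρ φ) c W f := by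
  let Q : Set (V → ℝ) := {f | f ∈ rankPolytope ρ φ ∧ ∀ v ∉ W, f v = 0}
  have hQ : IsCompact Q := by
    obtain ⟨i₀⟩ := ‹Nonempty ι›
    refine (isCompact_Icc (a := (0 : V → ℝ)) (b := fun v => φ i₀ (ρ i₀ {v}))).of_isClosed_subset
      ?_ ?_
    · have : Q = ((⋂ v, {f : V → ℝ | 0 ≤ f v}) ∩
          ⋂ i, ⋂ A : Finset V, {f : V → ℝ | ∑ v ∈ A, f v ≤ φ i (ρ i A)}) ∩
          ⋂ v, ⋂ _ : v ∉ W, {f : V → ℝ | f v = 0} := by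
        ext f
        simp [Q, rankPolytope]
      rw [this]
      refine IsClosed.inter (IsClosed.inter ?_ ?_) ?_
      · exact isClosed_iInter fun v => isClosed_le continuous_const (continuous_apply v)
      · exact isClosed_iInter fun i => isClosed_iInter fun A =>
          isClosed_le (by fun_prop) continuous_const
      · exact isClosed_iInter fun v => isClosed_iInter fun _ =>
          isClosed_eq (continuous_apply v) continuous_const
    · exact fun f hf => ⟨fun v => hf.1.1 v, fun v => by simpa using hf.1.2 i₀ {v}⟩
  obtain ⟨f, hf, hmax⟩ := hQ.exists_isMaxOn (f := fun f => c ⬝ᵥ f)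
    ⟨0, ⟨fun _ => le_rfl, fun i A => by simpa using hφ i A⟩, fun _ _ => rfl⟩
    (by unfold dotProduct; fun_prop)
  exact ⟨f, hf.1, hf.2, fun g hg hgW => hmax ⟨hg, hgW⟩⟩

section Optimum

variable {V ι : Type*} [Fintype V] [Fintype ι]

/-- The conditions on the objective `c`: it is not constant along the solution space of the
homogeneous system of any point that is not basic, and it separates basic points. -/
structure IsGenericObjective (ρ : ι → Finset V → ℕ) (φ : ι → ℕ → ℝ)
    (c : V → ℝ) : Prop where
  exists_ne_zero : ∀ f, ¬ IsBasic ρ φ f → ∃ u : V → ℝ, (∀ v, f v = 0 → u v = 0) ∧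
    (∀ p ∈ tightFlats ρ φ f, ∑ v ∈ p.2, u v = 0) ∧ c ⬝ᵥ u ≠ 0
  injOn : Set.InjOn (fun f => c ⬝ᵥ f) {f | IsBasic ρ φ f}

open Classical in
theorem exists_isGenericObjective (ρ : ι → Finset V → ℕ) (φ : ι → ℕ → ℝ) (c₀ : V → ℝ) {δ : ℝ}
    (hδ : 0 < δ) : ∃ c : V → ℝ, (∀ v, |c v - c₀ v| < δ) ∧ IsGenericObjective ρ φ c := by
  -- `D₁` consists of the differences of basic points; `D₂` has one nonzero solution of the
  -- homogeneous system for each support and set of tight flats that have one.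
  let K : Finset V × Finset (ι × Finset V) → (V → ℝ) → Prop := fun q u =>
    (∀ v ∉ q.1, u v = 0) ∧ (∀ p ∈ q.2, ∑ v ∈ p.2, u v = 0) ∧ u ≠ 0
  let D₁ : Set (V → ℝ) := Set.image2 (fun f g => f - g) {f | IsBasic ρ φ f} {f | IsBasic ρ φ f}
  let D₂ : Set (V → ℝ) := Set.range fun q => if h : ∃ u, K q u then h.choose else 0
  have hfin : ((D₁ ∪ D₂) \ {0}).Finite :=
    (((finite_setOf_isBasic ρ φ).image2 _ (finite_setOf_isBasic ρ φ)).union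
      (Set.finite_range _)).sdiff
  obtain ⟨c, hc, hD⟩ := exists_near_forall_dotProduct_ne_zero hfin (by simp) c₀ hδ
  refine ⟨c, hc, ⟨fun f hf => ?_, fun f hf g hg h => ?_⟩⟩
  · have hK : ∃ u, K (supportFinset f, tightFlats ρ φ f) u := by
      simp only [IsBasic, not_forall] at hf
      obtain ⟨u, h1, h2, h3⟩ := hf
      exact ⟨u, fun v hv => h1 v (not_not.1 (mt mem_supportFinset.2 hv)), h2, h3⟩
    obtain ⟨h1, h2, h3⟩ := hK.choose_spec
    refine ⟨hK.choose, fun v hv => h1 v (by simp [hv]), h2, ?_⟩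
    rw [dotProduct_comm]
    exact hD _ ⟨Or.inr ⟨(supportFinset f, tightFlats ρ φ f), dif_pos hK⟩, h3⟩
  · by_contra hne
    refine hD (f - g) ⟨Or.inl ⟨f, hf, g, hg, rfl⟩, sub_ne_zero.2 hne⟩ ?_
    rw [sub_dotProduct, dotProduct_comm, dotProduct_comm g, sub_eq_zero]
    exact h

variable [DecidableEq V] {ρ : ι → Finset V → ℕ} {φ : ι → ℕ → ℝ} {c f : V → ℝ} {W : Finset V}

theorem isFeasibleDirection_of_support (hφ : IsGenericPerturbation ρ φ)
    (hf : f ∈ rankPolytope ρ φ) {u : V → ℝ} (hu : ∀ v, f v = 0 → u v = 0)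
    (ht : ∀ p ∈ tightFlats ρ φ f, ∑ v ∈ p.2, u v ≤ 0) : IsFeasibleDirection ρ φ f u where
  nonneg v hv := (hu v hv).ge
  loop _ v hv := hu v (eq_zero_of_rank_singleton hφ hf hv)
  tight := ht

/-- At a point that is not basic, some `u` with `c ⬝ᵥ u ≠ 0` is feasible in both directions. -/
theorem IsOptimalOn.isBasic (hρ : ∀ i, IsRankFunction (ρ i)) (hφ : IsGenericPerturbation ρ φ)
    (hc : IsGenericObjective ρ φ c) (h : IsOptimalOn (rankPolytope ρ φ) c W f) :
    IsBasic ρ φ f := by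
  by_contra hb
  obtain ⟨u, hu, ht, hcu⟩ := hc.exists_ne_zero f hb
  have h1 := h.dotProduct_nonpos hρ
    (isFeasibleDirection_of_support hφ h.mem hu fun p hp => (ht p hp).le)
    fun v hv => hu v (h.eq_zero v hv)
  have h2 := h.dotProduct_nonpos hρ (u := -u)
    (isFeasibleDirection_of_support hφ h.mem (fun v hv => by simp [hu v hv])
      fun p hp => by simp [ht p hp])
    fun v hv => by simp [hu v (h.eq_zero v hv)]
  rw [dotProduct_neg] at h2
  exact hcu (by linarith)

theorem IsOptimalOn.eq_of_dotProduct_eq (hρ : ∀ i, IsRankFunction (ρ i))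
    (hφ : IsGenericPerturbation ρ φ) (hc : IsGenericObjective ρ φ c) {W' : Finset V}
    {g : V → ℝ} (hf : IsOptimalOn (rankPolytope ρ φ) c W f)
    (hg : IsOptimalOn (rankPolytope ρ φ) c W' g) (h : c ⬝ᵥ f = c ⬝ᵥ g) : f = g :=
  hc.injOn (hf.isBasic hρ hφ hc) (hg.isBasic hρ hφ hc) h

/-- Locality: optimality of `f` on `W` can be tested by adding the elements of `W` to the support of
`f` one at a time. -/
theorem isOptimalOn_of_forall_insert (hρ : ∀ i, IsRankFunction (ρ i))
    (hφ : IsGenericPerturbation ρ φ)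
    (h₀ : IsOptimalOn (rankPolytope ρ φ) c (supportFinset f) f) (hW : supportFinset f ⊆ W)
    (h : ∀ v ∈ W, IsOptimalOn (rankPolytope ρ φ) c (insert v (supportFinset f)) f) :
    IsOptimalOn (rankPolytope ρ φ) c W f := by
  have hf := h₀.mem
  refine ⟨hf, fun v hv => not_not.1 (mt mem_supportFinset.2 fun h' => hv (hW h')),
    fun g hg hgW => ?_⟩
  choose u hu hut using fun v : V =>
    hφ.exists_prescribed_sums hρ hf fun p => if v ∈ p.2 then (-1 : ℝ) else 0
  -- `e v` is the unit vector at `v`, corrected on the support of `f` so that all tight flats stay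
  -- tight; `d` is what remains of `g - f` after its part outside the support is removed this way.
  let N : Finset V := Finset.univ \ supportFinset f
  have hN : ∀ {v}, v ∈ N ↔ f v = 0 := fun {v} => by simp [N]
  let e : V → V → ℝ := fun v => Pi.single v 1 + u v
  have he : ∀ v, ∀ p ∈ tightFlats ρ φ f, ∑ w ∈ p.2, e v w = 0 := fun v p hp => by
    simp only [e, Pi.add_apply, Finset.sum_add_distrib, hut v p hp, Finset.sum_pi_single']
    split_ifs <;> simp
  have he' : ∀ v w, f w = 0 → e v w = if w = v then 1 else 0 := fun v w hw => by
    simp [e, hu v w hw, Pi.single_apply]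
  let d : V → ℝ := g - f - ∑ v ∈ N, g v • e v
  have hd : ∀ w, f w = 0 → d w = 0 := fun w hw => by
    simp [d, hw, he' _ w hw, hN]
  have hdt : ∀ p ∈ tightFlats ρ φ f, ∑ w ∈ p.2, d w ≤ 0 := fun p hp => by
    have h1 : ∑ w ∈ p.2, d w = ∑ w ∈ p.2, g w - ∑ w ∈ p.2, f w := by
      simp only [d, Pi.sub_apply, Finset.sum_apply, Pi.smul_apply, smul_eq_mul,
        Finset.sum_sub_distrib]
      rw [Finset.sum_comm]
      simp only [← Finset.mul_sum, he _ p hp]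
      simp
    rw [h1, (mem_tightFlats.1 hp).2.2]
    linarith [hg.2 p.1 p.2]
  have hcd : c ⬝ᵥ d ≤ 0 := h₀.dotProduct_nonpos hρ
    (isFeasibleDirection_of_support hφ hf hd hdt)
    fun v hv => hd v (not_not.1 (mt mem_supportFinset.2 hv))
  have hce : ∀ v ∈ N, g v * (c ⬝ᵥ e v) ≤ 0 := fun v hv => by
    by_cases hgv : g v = 0
    · simp [hgv]
    refine mul_nonpos_of_nonneg_of_nonpos (hg.1 v) ?_
    have hvW : v ∈ W := by
      by_contra hv'
      exact hgv (hgW v hv')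
    refine (h v hvW).dotProduct_nonpos hρ ⟨fun w hw => ?_, fun i w hw => ?_,
      fun p hp => (he v p hp).le⟩ fun w hw => ?_
    · rw [he' v w hw]
      split_ifs <;> norm_num
    -- A loop `v` would force `g v = 0`.
    · rw [he' v w (eq_zero_of_rank_singleton hφ hf hw), if_neg]
      rintro rfl
      exact hgv (eq_zero_of_rank_singleton hφ hg hw)
    · simp only [Finset.mem_insert, mem_supportFinset, not_or, not_not] at hw
      rw [he' v w hw.2, if_neg hw.1]
  have hsum : c ⬝ᵥ g = c ⬝ᵥ f + c ⬝ᵥ d + ∑ v ∈ N, g v * (c ⬝ᵥ e v) := by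
    have hg' : g = f + d + ∑ v ∈ N, g v • e v := by
      simp only [d]; abel
    conv_lhs => rw [hg']
    simp only [dotProduct_add, dotProduct_sum, dotProduct_smul, smul_eq_mul]
  linarith [Finset.sum_nonpos hce]

theorem card_tightFlats_le (hρ : ∀ i, IsRankFunction (ρ i)) (hφ : IsGenericPerturbation ρ φ)
    (hf : f ∈ rankPolytope ρ φ) {m : ℕ} (hm : ∀ p ∈ tightFlats ρ φ f, ρ p.1 p.2 ≤ m) :
    (tightFlats ρ φ f).card ≤ Fintype.card ι * m := by
  calc (tightFlats ρ φ f).card ≤ ((Finset.univ : Finset ι) ×ˢ Finset.Icc 1 m).card :=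
        Finset.card_le_card_of_injOn (fun p => (p.1, ρ p.1 p.2))
          (fun p hp => by simpa using ⟨(mem_tightFlats.1 hp).1, hm p hp⟩)
          (injOn_rank_tightFlats hρ hφ hf)
    _ = Fintype.card ι * m := by simp

end Optimum

/-! ### Collapsing along level sets -/

section Collapse

variable {V : Type*} [Fintype V]

/-- A sublevel set of a monotone function whose level sets are intervals with lower ends of size at
most `d` is `d`-collapsible. -/
theorem isCollapsible_of_forall_level_interval {d : ℕ} {μ : Finset V → ℝ} (hμ : Monotone μ)
    (C : LowerSet (Finset V)) (κ : ℝ) (hC : ∀ W, W ∈ C ↔ μ W < κ)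
    (h : ∀ W ∈ C, ∃ S U : Finset V, S.card ≤ d ∧ ∀ F, μ F = μ W ↔ S ⊆ F ∧ F ⊆ U) :
    IsCollapsible d C := by
  have : Finite (LowerSet (Finset V)) := Finite.of_injective _ SetLike.coe_injective
  induction C using WellFoundedLT.induction generalizing κ with
  | ind C ih =>
  by_cases hne : ∃ W, W ∈ C
  · obtain ⟨W, hWC, hmax⟩ := (Set.toFinite {W | W ∈ C}).exists_maximalFor μ _ hne
    replace hmax : ∀ F ∈ C, μ F ≤ μ W := fun F hF => by
      by_contra! hlt
      exact absurd (hmax hF hlt.le) (not_le.2 hlt)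
    obtain ⟨S, U, hS, hSU⟩ := h W hWC
    obtain ⟨hSW, hWU⟩ := (hSU W).1 rfl
    have hlevel : ∀ F ∈ C, S ⊆ F → μ F = μ W := fun F hF hSF =>
      (hmax F hF).antisymm (((hSU S).2 ⟨subset_rfl, hSW.trans hWU⟩).ge.trans (hμ hSF))
    have hUC : U ∈ C :=
      (hC U).2 (((hSU U).2 ⟨hSW.trans hWU, subset_rfl⟩).trans_lt ((hC W).1 hWC))
    let C' : LowerSet (Finset V) :=
      ⟨{F | μ F < μ W}, fun _ _ hle hlt => (hμ hle).trans_lt hlt⟩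
    have hC'C : ∀ F ∈ C', F ∈ C := fun F hF => (hC F).2 (lt_trans hF ((hC W).1 hWC))
    have hlt : C' < C := by
      refine lt_of_le_of_ne hC'C ?_
      rintro rfl
      exact lt_irrefl (μ W) hWC
    refine Relation.ReflTransGen.head ⟨S, C.lower hSW hWC, hS, ⟨U, ⟨⟨hUC, ?_⟩, ?_⟩, ?_⟩, ?_⟩
      (ih C' hlt (μ W) (fun _ => Iff.rfl) fun F hF => h F (hC'C F hF))
    · exact fun F hF hUF => ((hSU F).1 (hlevel F hF ((hSW.trans hWU).trans hUF))).2
    · exact hSW.trans hWU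
    · rintro F ⟨hF, hSF⟩
      have hFU := ((hSU F).1 (hlevel F hF.prop hSF)).2
      exact hFU.antisymm (hF.le_of_ge hUC hFU)
    · refine fun F => ⟨fun hF => ⟨hC'C F hF, fun hSF => ?_⟩, fun hF => ?_⟩
      · exact (ne_of_lt (show μ F < μ W from hF)) (hlevel F (hC'C F hF) hSF)
      · exact (hmax F hF.1).lt_of_ne fun he => hF.2 ((hSU F).1 he).1
  · have : C = ⊥ := by
      ext F
      simpa using fun hF => hne ⟨F, hF⟩
    rw [this]
    exact Relation.ReflTransGen.refl

/-- The level sets of the optimal value are intervals: the lower end is the support of the common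
optimum, the upper end the set of elements whose addition to the support does not destroy its
optimality. -/
theorem isCollapsible_of_generic {ι : Type*} [Fintype ι] [Nonempty ι] [DecidableEq V]
    {ρ : ι → Finset V → ℕ} {φ : ι → ℕ → ℝ} {c : V → ℝ} (hρ : ∀ i, IsRankFunction (ρ i))
    (hφ : IsGenericPerturbation ρ φ) (hφ₀ : ∀ i A, 0 ≤ φ i (ρ i A))
    (hc : IsGenericObjective ρ φ c) {C : LowerSet (Finset V)} {κ : ℝ}
    (hC : ∀ W f, IsOptimalOn (rankPolytope ρ φ) c W f → (W ∈ C ↔ c ⬝ᵥ f < κ)) {m : ℕ}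
    (hm : ∀ W ∈ C, ∀ f, IsOptimalOn (rankPolytope ρ φ) c W f →
      ∀ p ∈ tightFlats ρ φ f, ρ p.1 p.2 ≤ m) :
    IsCollapsible (Fintype.card ι * m) C := by
  classical
  choose opt hopt using exists_isOptimalOn hφ₀ c
  refine isCollapsible_of_forall_level_interval (μ := fun W => c ⬝ᵥ opt W) (fun W W' hW => ?_)
    C κ (fun W => hC W _ (hopt W)) fun W hW => ?_
  · exact (hopt W').le _ (hopt W).mem fun v hv => (hopt W).eq_zero v fun h => hv (hW h)
  · have hsupp := (hopt W).supportFinset_subset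
    have h₀ := (hopt W).mono hsupp subset_rfl
    refine ⟨supportFinset (opt W), Finset.univ.filter fun v =>
      IsOptimalOn (rankPolytope ρ φ) c (insert v (supportFinset (opt W))) (opt W), ?_,
      fun F => ⟨fun hF => ?_, fun hF => ?_⟩⟩
    · exact ((hopt W).isBasic hρ hφ hc).card_supportFinset_le.trans
        (card_tightFlats_le hρ hφ (hopt W).mem (hm W hW _ (hopt W)))
    · have hoptF := hopt F
      rw [(hopt F).eq_of_dotProduct_eq hρ hφ hc (hopt W) hF] at hoptF
      refine ⟨hoptF.supportFinset_subset, fun v hv => ?_⟩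
      simp only [Finset.mem_filter, Finset.mem_univ, true_and]
      exact hoptF.mono (Finset.insert_subset hv hoptF.supportFinset_subset)
        (Finset.subset_insert _ _)
    · have hoptF := isOptimalOn_of_forall_insert hρ hφ h₀ hF.1
        fun v hv => (Finset.mem_filter.1 (hF.2 hv)).2
      exact le_antisymm (hoptF.le _ (hopt F).mem (hopt F).eq_zero)
        ((hopt F).le _ hoptF.mem hoptF.eq_zero)

end Collapse

/-! ### Existence of a generic perturbation of the ranks -/

section Perturbation

variable {V ι : Type*} [Fintype V] [DecidableEq V] [Fintype ι]

/-- A function close to `j ↦ j - ε j ^ 2` satisfies the strict exchange inequality. If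
`s + t = a + b`, the gain is `2 ε (a - t) (b - t) ≥ 2 ε`; if `s + t < a + b`, it comes from the
linear term. -/
theorem strict_concavity_of_near {N : ℕ} {ε δ : ℝ} (hε : 0 < ε) (hδ : 4 * δ < ε)
    (hN : ε * (2 * N ^ 2 + 1) ≤ 1) {ψ : ℕ → ℝ}
    (hψ : ∀ j, |ψ j - (j - ε * j ^ 2)| ≤ δ) {a b s t : ℕ} (ha : a ≤ N) (hb : b ≤ N)
    (hta : t < a) (htb : t < b) (hst : s + t ≤ a + b) : ψ s + ψ t < ψ a + ψ b := by
  have h1 := abs_le.1 (hψ a)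
  have h2 := abs_le.1 (hψ b)
  have h3 := abs_le.1 (hψ s)
  have h4 := abs_le.1 (hψ t)
  have ha' : (a : ℝ) ≤ N := by exact_mod_cast ha
  have hb' : (b : ℝ) ≤ N := by exact_mod_cast hb
  have ha0 : (0 : ℝ) ≤ a := a.cast_nonneg
  have hb0 : (0 : ℝ) ≤ b := b.cast_nonneg
  have hsq : (a : ℝ) ^ 2 + b ^ 2 ≤ 2 * N ^ 2 := by nlinarith
  rcases hst.eq_or_lt with h | h
  · have hs : (s : ℝ) = a + b - t := by
      have : (s : ℝ) + t = a + b := by exact_mod_cast h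
      linarith
    have hta' : (t : ℝ) + 1 ≤ a := by exact_mod_cast hta
    have htb' : (t : ℝ) + 1 ≤ b := by exact_mod_cast htb
    have hprod : 1 ≤ ((a : ℝ) - t) * (b - t) := by nlinarith
    have := mul_le_mul_of_nonneg_left hprod hε.le
    rw [hs] at h3
    nlinarith
  · have hs : (s : ℝ) + t + 1 ≤ a + b := by exact_mod_cast h
    have h5 := mul_le_mul_of_nonneg_left hsq hε.le
    have h6 : 0 ≤ ε * ((s : ℝ) ^ 2 + t ^ 2) := by positivity
    nlinarith

open Classical in
theorem exists_isGenericPerturbation {ρ : ι → Finset V → ℕ} (hρ : ∀ i, IsRankFunction (ρ i))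
    {η : ℝ} (hη : 0 < η) (hη1 : η ≤ 1) :
    ∃ φ : ι → ℕ → ℝ, IsGenericPerturbation ρ φ ∧
      ∀ i A, (1 - η) * ρ i A ≤ φ i (ρ i A) ∧ φ i (ρ i A) ≤ ρ i A := by
  let N : ℕ := ∑ i, ρ i Finset.univ
  have hN : ∀ i A, ρ i A ≤ N := fun i A => ((hρ i).mono (Finset.subset_univ A)).trans
    (Finset.single_le_sum (f := fun i => ρ i Finset.univ) (fun _ _ => Nat.zero_le _)
      (Finset.mem_univ i))
  obtain ⟨ε, hε, hεN⟩ : ∃ ε : ℝ, 0 < ε ∧ ε * (2 * N ^ 2 + 1) = η :=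
    ⟨η / (2 * N ^ 2 + 1), by positivity, by field_simp⟩
  let coord : ι → ℕ → ι × Fin (N + 1) := fun i j => (i, Fin.ofNat (N + 1) j)
  -- For each pair `(S, T)` with a nontrivial relation, one such relation is chosen and turned into
  -- a hyperplane in the space of the values `φ i j`, `j ≤ N`, that `φ` has to avoid.
  let K : Finset V × Finset (ι × Finset V) → (ι × Finset V → ℝ) → Prop := fun q l =>
    (∃ p ∈ q.2, l p ≠ 0) ∧ ∀ v ∈ q.1, ∑ p ∈ q.2, (if v ∈ p.2 then l p else 0) = 0
  let D : Set (ι × Fin (N + 1) → ℝ) := Set.range fun q : Finset V × Finset (ι × Finset V) =>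
    if h : ∃ l, K q l then
      ∑ p ∈ q.2, h.choose p • Pi.single (coord p.1 (ρ p.1 p.2)) (1 : ℝ) else 0
  obtain ⟨x, hx, hD⟩ := exists_near_forall_dotProduct_ne_zero (D := D \ {0})
    (Set.finite_range _).sdiff (by simp)
    (fun q => (q.2 : ℝ) - ε * (q.2 : ℝ) ^ 2) (δ := ε / 5) (by positivity)
  let φ : ι → ℕ → ℝ := fun i j => if j = 0 then 0 else if j ≤ N then x (coord i j) else
    j - ε * j ^ 2
  have hcoord : ∀ i j, j ≤ N → ((coord i j).2 : ℕ) = j := fun i j hj => by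
    simp [coord, Nat.mod_eq_of_lt (Nat.lt_succ_of_le hj)]
  have hφ : ∀ i j, |φ i j - (j - ε * j ^ 2)| ≤ ε / 5 := fun i j => by
    by_cases hj : j = 0
    · simp [φ, hj]; positivity
    by_cases hjN : j ≤ N
    · have := (hx (coord i j)).le
      rw [hcoord i j hjN] at this
      simpa [φ, hj, hjN] using this
    · simp [φ, hj, hjN]; positivity
  refine ⟨φ, ⟨fun i => by simp [φ], fun i A B hA hB => ?_, fun S T hinj hpos hl => ?_⟩,
    fun i A => ?_⟩
  · exact strict_concavity_of_near hε (by linarith) (hεN.trans_le hη1) (hφ i) (hN i A) (hN i B)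
      hA hB ((hρ i).submod A B)
  · have hK : ∃ l, K (S, T) l := hl
    obtain ⟨⟨p, hp, hlp⟩, hlS⟩ := hK.choose_spec
    refine ⟨hK.choose, hlS, ?_⟩
    let w : ι × Fin (N + 1) → ℝ :=
      ∑ p ∈ T, hK.choose p • Pi.single (coord p.1 (ρ p.1 p.2)) (1 : ℝ)
    have hwD : w ∈ D := ⟨(S, T), dif_pos hK⟩
    -- By injectivity of the ranks on `T`, the coefficients of the relation are coordinates of `w`.
    have hw : w ≠ 0 := fun h0 => hlp <| by
      have h1 := congrFun h0 (coord p.1 (ρ p.1 p.2))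
      simp only [w, Finset.sum_apply, Pi.smul_apply, smul_eq_mul, Pi.zero_apply] at h1
      rw [Finset.sum_eq_single p] at h1
      · simpa using h1
      · intro q hq hqp
        rw [Pi.single_eq_of_ne, mul_zero]
        intro heq
        refine hqp (hinj hq hp (Prod.ext (Prod.mk.inj heq).1.symm ?_))
        have := congrArg (fun z : ι × Fin (N + 1) => (z.2 : ℕ)) heq
        simp only [hcoord _ _ (hN _ _)] at this
        exact this.symm
      · exact fun h => absurd hp h
    have := hD w ⟨hwD, hw⟩
    convert this using 1
    simp only [w, sum_dotProduct, smul_dotProduct, smul_eq_mul, single_one_dotProduct]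
    refine Finset.sum_congr rfl fun q hq => ?_
    simp [φ, (hpos q hq).ne', hN]
  · by_cases h0 : ρ i A = 0
    · simp [φ, h0]
    have h1 : (1 : ℝ) ≤ ρ i A := by exact_mod_cast Nat.pos_of_ne_zero h0
    have h2 : (ρ i A : ℝ) ≤ N := by exact_mod_cast hN i A
    have h3 := abs_le.1 (hφ i (ρ i A))
    have h4 : (ρ i A : ℝ) ^ 2 ≤ N ^ 2 := by gcongr
    have h5 := mul_le_mul_of_nonneg_left h4 hε.le
    have h6 : ε * 1 ≤ ε * (ρ i A : ℝ) ^ 2 := by gcongr; nlinarith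
    have h7 : 0 ≤ ε * (N : ℝ) ^ 2 := by positivity
    constructor
    · nlinarith
    · linarith

end Perturbation

/-! ### The matching complex -/

theorem isRankFunction_toNat_eRk {V : Type*} [DecidableEq V] (M : Matroid V) :
    IsRankFunction fun A : Finset V => (M.eRk (A : Set V)).toNat := by
  have htop : ∀ A : Finset V, M.eRk (A : Set V) ≠ ⊤ := fun A =>
    ne_top_of_le_ne_top (by simp) (M.eRk_le_encard (A : Set V))
  refine ⟨fun A B h => ?_, fun A B => ?_⟩
  · exact ENat.toNat_le_toNat (M.eRk_mono (Finset.coe_subset.2 h)) (htop B)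
  · rw [← ENat.toNat_add (htop _) (htop _), ← ENat.toNat_add (htop _) (htop _)]
    refine ENat.toNat_le_toNat ?_ (by simp [htop])
    rw [add_comm]
    simpa using M.eRk_submod (A : Set V) B

end MatroidalMatching

open MatroidalMatching in
theorem theorem2p2 {V : Type*} [Fintype V] {r : ℕ} [NeZero r] (M : Fin r → Matroid V)
    (hM : ∀ i, (M i).E = Set.univ) (k : ℝ) (hk : 0 < k) :
    MatroidalMatching.IsCollapsible (r * ⌈k⌉₊ - r) (MatroidalMatching.matchingComplex M k) := by
  classical
  let ρ : Fin r → Finset V → ℕ := fun i A => ((M i).eRk (A : Set V)).toNat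
  have hρ : ∀ i, IsRankFunction (ρ i) := fun i => isRankFunction_toNat_eRk (M i)
  -- Finitely many values of `ν*` occur, so those below `k` are at most some `k₀ < k`. The
  -- perturbation changes values by a factor between `(1 - η) ^ 2` and `1` and hence keeps
  -- the two sides apart.
  obtain ⟨k₀, hk₀, hk₀k, hbound⟩ : ∃ k₀ : ℝ, 0 ≤ k₀ ∧ k₀ < k ∧
      ∀ W, nuStar M W < k → nuStar M W ≤ k₀ := by
    obtain ⟨W₀, hW₀, hmax⟩ :=
      (insert 0 ((Finset.univ.image (nuStar M)).filter (· < k))).exists_max_image id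
        ⟨0, Finset.mem_insert_self _ _⟩
    refine ⟨W₀, hmax 0 (Finset.mem_insert_self _ _), ?_, fun W hW => hmax _ ?_⟩
    · rcases Finset.mem_insert.1 hW₀ with rfl | h
      exacts [hk, (Finset.mem_filter.1 h).2]
    · exact Finset.mem_insert_of_mem
        (Finset.mem_filter.2 ⟨Finset.mem_image_of_mem _ (Finset.mem_univ W), hW⟩)
  obtain ⟨η, hη, hη1, hηk⟩ : ∃ η : ℝ, 0 < η ∧ η < 1 ∧ k₀ < (1 - η) ^ 2 * k := by
    refine ⟨(k - k₀) / (4 * k), div_pos (by linarith) (by linarith), ?_, ?_⟩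
    · rw [div_lt_one (by linarith)]; linarith
    · have h1 : (k - k₀) / (4 * k) * k = (k - k₀) / 4 := by field_simp
      nlinarith [mul_nonneg (sq_nonneg ((k - k₀) / (4 * k))) hk.le]
  obtain ⟨φ, hφ, hφρ⟩ := exists_isGenericPerturbation hρ hη hη1.le
  obtain ⟨c, hcη, hc⟩ := exists_isGenericObjective ρ φ (fun _ => 1 - η / 2) (half_pos hη)
  have hc' : ∀ v, 1 - η ≤ c v ∧ c v ≤ 1 := fun v => by
    have := abs_lt.1 (hcη v)
    constructor <;> linarith
  have hle : ∀ W f, IsOptimalOn (rankPolytope ρ φ) c W f → ∑ v, f v ≤ nuStar M W := by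
    intro W f hf
    refine (isGreatest_nuStar M W).2
      ⟨f, ⟨Set.mem_iInter.2 fun i => ⟨hf.mem.1, fun A => ?_⟩, ?_⟩, rfl⟩
    · exact (hf.mem.2 i A).trans (hφρ i A).2
    · exact Function.support_subset_iff'.2 hf.eq_zero
  have hdot : ∀ f ∈ rankPolytope ρ φ, c ⬝ᵥ f ≤ ∑ v, f v := fun f hf =>
    Finset.sum_le_sum fun v _ => mul_le_of_le_one_left (hf.1 v) (hc' v).2
  have hge : ∀ W f, IsOptimalOn (rankPolytope ρ φ) c W f →
      (1 - η) ^ 2 * nuStar M W ≤ c ⬝ᵥ f := by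
    intro W f hf
    obtain ⟨g, ⟨hgP, hgW⟩, hg⟩ := (isGreatest_nuStar M W).1
    have hgP' := Set.mem_iInter.1 hgP
    have hg0 : ∀ v, 0 ≤ g v := (hgP' 0).1
    have h1 : (1 - η) • g ∈ rankPolytope ρ φ := by
      refine ⟨fun v => mul_nonneg (by linarith) (hg0 v), fun i A => ?_⟩
      simp only [Pi.smul_apply, smul_eq_mul, ← Finset.mul_sum]
      exact (mul_le_mul_of_nonneg_left ((hgP' i).2 A) (by linarith)).trans (hφρ i A).1
    have h2 := hf.le _ h1 fun v hv => by
      simp [Function.support_subset_iff'.1 hgW v hv]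
    refine le_trans ?_ h2
    rw [dotProduct_smul, smul_eq_mul, sq, mul_assoc]
    refine mul_le_mul_of_nonneg_left ?_ (by linarith)
    rw [← hg, Finset.mul_sum]
    exact Finset.sum_le_sum fun v _ => mul_le_mul_of_nonneg_right (hc' v).1 (hg0 v)
  have key := isCollapsible_of_generic (C := matchingComplex M k) (κ := (1 - η) ^ 2 * k)
    (m := ⌈k⌉₊ - 1) hρ hφ
    (fun i A => (mul_nonneg (by linarith) (Nat.cast_nonneg _)).trans (hφρ i A).1) hc
    (fun W f hf => ⟨fun hW => ?_, fun hlt => ?_⟩) ?_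
  · simpa [Nat.mul_sub] using key
  · exact ((hdot f hf.mem).trans ((hle W f hf).trans (hbound W hW))).trans_lt hηk
  · exact lt_of_mul_lt_mul_left ((hge W f hf).trans_lt hlt) (sq_nonneg _)
  · intro W hW f hf p hp
    have h1 : φ p.1 (ρ p.1 p.2) ≤ k₀ := by
      rw [← (mem_tightFlats.1 hp).2.2]
      exact (Finset.sum_le_univ_sum_of_nonneg hf.mem.1).trans ((hle W f hf).trans (hbound W hW))
    have h2 : (ρ p.1 p.2 : ℝ) < k := by
      have h3 := (hφρ p.1 p.2).1
      have h4 : (1 - η) ^ 2 * k ≤ (1 - η) * k := by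
        have := mul_nonneg (mul_nonneg hη.le (by linarith : (0 : ℝ) ≤ 1 - η)) hk.le
        nlinarith
      exact lt_of_mul_lt_mul_left (by linarith : (1 - η) * (ρ p.1 p.2 : ℝ) < (1 - η) * k)
        (by linarith)
    have := Nat.lt_ceil.2 h2
    omega
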